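/- For integers $m\ge 1$ put $c_m=1-\frac{6}{(m+2)(m+3)}$ and $h^{(m)}_{r,s}=\frac{[r(m+3)-s(m+2)]^2-1}{4(m+2)(m+3)}$, so that $h^{(m)}_{m+1,1}=\frac{m(m+1)}{4}$. Let $n\ge 3$ and $m\ge 2$, and let $V=(V,\mathbf 1,\omega,Y)$ be a vertex operator algebra over $\mathbb C$, with $Y(u,z)=\sum_{k\in\mathbb Z}u_kz^{-k-1}$, satisfying the following two conditions. (I) $V$ is simple, of OZ type (i.e. $V=\bigoplus_{k\ge 0}V_k$, $V_0=\mathbb C\mathbf 1$, $V_1=0$), and generated by its Griess algebra $V_2$. (II) $V_2$ is linearly spanned by vectors $\omega^{ij}=\omega^{ji}$, $1\le i<j\le n$, such that each vertex subalgebra generated by $\omega^{ij}$, with conformal vector $\omega^{ij}$, is isomorphic to the simple Virasoro vertex operator algebra $L(c_m,0)$, and, for distinct $i,j,k,l\in\{1,\dots,n\}$ (for distinct $i,j,l$ in the relations that involve only these), $$\omega^{ij}_1\omega^{jl}=\tfrac12 h^{(m)}_{m+1,1}(\omega^{ij}+\omega^{jl}-\omega^{il}),\qquad \omega^{ij}_p\omega^{kl}=0\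 (p\ge 0),$$ $$\omega^{ij}_3\omega^{ij}=\tfrac{c_m}{2}\mathbf 1,\qquad \omega^{ij}_3\omega^{jl}=\tfrac{c_m h^{(m)}_{m+1,1}}{8}\mathbf 1 .$$ Let $(\cdot|\cdot)$ be the non-degenerate bilinear form on $V$ with $(\mathbf 1|\mathbf 1)=1$ and $(v|Y(u,z)w)=(Y(e^{zL(1)}(-z^{-2})^{L(0)}u,z^{-1})v|w)$ for all $u,v,w\in V$, where $Y(\omega,z)=\sum_k L(k)z^{-k-2}$. Let $(\cdot|\cdot)_H$ be the associated Hermitian form on $V$, i.e. the form that is linear in the first and conjugate-linear in the second variable and satisfies $(au|bv)_H=a\bar b\,(u|v)$ for all $a,b\in\mathbb C$ and all vectors $u,v$ of the form $\omega^{i_1j_1}_{k_1}\cdots\omega^{i_sj_s}_{k_s}\mathbf 1$ with $s\ge 0$, $i_t<j_t$, $k_t\in\mathbb Z$. If $n=3$, then the restriction of $(\cdot|\cdot)_H$ to $V_2$ is positive definite if and only if $m\le 3$. If $n\ge 4$, then the restriction of $(\cdot|\cdot)_H$ to $V_2$ is positive definite if and only if $m=2$. -/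

import Mathlib

open scoped ComplexConjugate

noncomputable section

/-- A vertex operator algebra `(V, 1, ω, Y)` over `ℂ`. The state-field map `Y` sends `u` to
`Y(u, z) = ∑ uₙ z^{-n-1}`, a linear map from `V` to Laurent series with coefficients in `V`
(so `uₙ v = 0` for `n ≫ 0` is built in); `uₙ` is `VertexOperator.ncoeff (Y u) n`. -/
structure VertexOperatorAlgebra (V : Type*) [AddCommGroup V] [Module ℂ V] where
  /-- the state-field correspondence -/
  Y : V →ₗ[ℂ] VertexOperator ℂ V
  /-- the vacuum vector -/
  vac : V
  /-- the conformal vector -/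
  conf : V
  /-- the central charge -/
  charge : ℂ
  /-- the homogeneous subspaces `V_k` -/
  gr : ℤ → Submodule ℂ V
  gr_internal : DirectSum.IsInternal gr
  gr_finite : ∀ k, Module.Finite ℂ (gr k)
  gr_bounded : ∃ N : ℤ, ∀ k < N, gr k = ⊥
  vac_mem : vac ∈ gr 0
  conf_mem : conf ∈ gr 2
  /-- `Y(1, z) = id` -/
  vac_mode : ∀ (n : ℤ) (v : V),
    VertexOperator.ncoeff (Y vac) n v = if n = -1 then v else 0
  /-- `Y(u, z) 1` has no negative powers of `z` and constant term `u` -/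
  mode_vac_of_nonneg : ∀ (u : V) (n : ℤ), 0 ≤ n → VertexOperator.ncoeff (Y u) n vac = 0
  mode_neg_one_vac : ∀ u : V, VertexOperator.ncoeff (Y u) (-1) vac = u
  /-- the Virasoro relations for `L(p) = ω_{p+1}` -/
  virasoro : ∀ (p q : ℤ) (v : V),
    VertexOperator.ncoeff (Y conf) (p + 1) (VertexOperator.ncoeff (Y conf) (q + 1) v) -
      VertexOperator.ncoeff (Y conf) (q + 1) (VertexOperator.ncoeff (Y conf) (p + 1) v) =
    ((p : ℂ) - q) • VertexOperator.ncoeff (Y conf) (p + q + 1) v +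
      if p + q = 0 then ((((p : ℂ) ^ 3 - p) / 12) * charge) • v else 0
  /-- `L(0)` acts on `V_k` as `k` -/
  L_zero : ∀ (k : ℤ), ∀ v ∈ gr k, VertexOperator.ncoeff (Y conf) 1 v = (k : ℂ) • v
  /-- the Jacobi identity, in components (all sums have finite support by truncation) -/
  jacobi : ∀ (u v w : V) (p q r : ℤ),
    ∑ᶠ i : ℕ, (Ring.choose p i : ℤ) •
      VertexOperator.ncoeff (Y (VertexOperator.ncoeff (Y u) (r + i) v)) (p + q - i) w =
    ∑ᶠ i : ℕ, ((-1 : ℤ) ^ i * (Ring.choose r i : ℤ)) •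
      (VertexOperator.ncoeff (Y u) (p + r - i) (VertexOperator.ncoeff (Y v) (q + i) w) -
        (Int.negOnePow r : ℤ) •
          VertexOperator.ncoeff (Y v) (q + r - i) (VertexOperator.ncoeff (Y u) (p + i) w))

namespace VertexOperatorAlgebra

variable {V : Type*} [AddCommGroup V] [Module ℂ V] (A : VertexOperatorAlgebra V)

/-- The `n`-th mode `uₙ` of `u`. -/
def mode (u : V) (n : ℤ) : Module.End ℂ V := VertexOperator.ncoeff (A.Y u) n

/-- `L(n) = ω_{n+1}`. -/
def L (n : ℤ) : Module.End ℂ V := A.mode A.conf (n + 1)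

/-- `V` is simple: `V` is an irreducible module over itself. -/
def IsSimple : Prop :=
  Nontrivial V ∧ ∀ W : Submodule ℂ V, (∀ u : V, ∀ n : ℤ, ∀ w ∈ W, A.mode u n w ∈ W) →
    W = ⊥ ∨ W = ⊤

/-- `V` is of OZ type: `V = ⨁_{k ≥ 0} V_k`, `V_0 = ℂ1` and `V_1 = 0`. -/
def IsOZ : Prop :=
  (∀ k < 0, A.gr k = ⊥) ∧ A.gr 0 = Submodule.span ℂ {A.vac} ∧ A.gr 1 = ⊥

/-- A subspace that contains the vacuum and is closed under all products `uₙ v`. -/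
def IsVertexSubalgebra (U : Submodule ℂ V) : Prop :=
  A.vac ∈ U ∧ ∀ u ∈ U, ∀ n : ℤ, ∀ v ∈ U, A.mode u n v ∈ U

/-- The vertex subalgebra `⟨S⟩` generated by a set `S`. -/
def generatedBy (S : Set V) : Submodule ℂ V :=
  sInf {U : Submodule ℂ V | A.IsVertexSubalgebra U ∧ S ⊆ U}

/-- `U`, with the vector `x` and the operators `L n` restricted to `U`, is the irreducible highest
weight module `L(c, 0)` of the Virasoro algebra (central charge `c`, highest weight `0`), with
highest weight vector `x`. The condition `L(-1) x = 0` is automatic in `L(c, 0)`. -/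
structure IsSimpleVirasoroModule (U : Submodule ℂ V) (L : ℤ → Module.End ℂ V) (x : V) (c : ℂ) :
    Prop where
  vec_mem : x ∈ U
  vec_ne_zero : x ≠ 0
  stable : ∀ p : ℤ, ∀ u ∈ U, L p u ∈ U
  relation : ∀ p q : ℤ, ∀ u ∈ U, L p (L q u) - L q (L p u) =
    ((p : ℂ) - q) • L (p + q) u + if p + q = 0 then ((((p : ℂ) ^ 3 - p) / 12) * c) • u else 0
  highest : ∀ p : ℤ, 0 ≤ p → L p x = 0
  irreducible : ∀ W : Submodule ℂ V, W ≤ U → (∀ p : ℤ, ∀ w ∈ W, L p w ∈ W) → W = ⊥ ∨ W = U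

/-- `e ∈ V_2` is a simple Virasoro vector of central charge `c`: the vertex subalgebra `⟨e⟩`, with
conformal vector `e`, is isomorphic to the simple Virasoro vertex operator algebra `L(c, 0)`.
As `⟨e⟩` is generated by `e`, this says that `⟨e⟩` is the irreducible Virasoro module `L(c, 0)`
under `L^e(n) = e_{n+1}`, with the vacuum as highest weight vector. -/
def IsSimpleVirasoroVector (e : V) (c : ℂ) : Prop :=
  e ∈ A.gr 2 ∧
    IsSimpleVirasoroModule (A.generatedBy {e}) (fun p => A.mode e (p + 1)) A.vac c

/-- The invariance `(v | Y(u,z)w) = (Y(e^{zL(1)}(-z^{-2})^{L(0)}u, z^{-1})v | w)`, read off at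
`z^{-n-1}` for homogeneous `u ∈ V_k`:
`(v | uₙ w) = ∑_{i ≥ 0} ((-1)^k / i!) ((L(1)^i u)_{2k-n-i-2} v | w)`; the sum is finite. -/
def IsInvariant (B : V →ₗ[ℂ] V →ₗ[ℂ] ℂ) : Prop :=
  ∀ k : ℤ, ∀ u ∈ A.gr k, ∀ (v w : V) (n : ℤ),
    B v (A.mode u n w) =
      ∑ᶠ i : ℕ, ((Int.negOnePow k : ℤ) : ℂ) / (i.factorial : ℂ) *
        B (A.mode (((A.L 1) ^ i) u) (2 * k - n - i - 2) v) w

/-- The non-degenerate invariant bilinear form `(·|·)` with `(1|1) = 1`. -/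
structure IsNormalizedInvariantForm (B : V →ₗ[ℂ] V →ₗ[ℂ] ℂ) : Prop where
  invariant : A.IsInvariant B
  nondegenerate : B.Nondegenerate
  vac_vac : B A.vac A.vac = 1

/-- The vectors `ω^{i₁j₁}_{m₁} ⋯ ω^{i_sj_s}_{m_s} 1` with `i_k < j_k` and `m_k ∈ ℤ`, `s ≥ 0`. -/
inductive IsMonomial {n : ℕ} (om : Fin n → Fin n → V) : V → Prop
  | vac : IsMonomial om A.vac
  | mode (i j : Fin n) (hij : i < j) (p : ℤ) (u : V) (hu : IsMonomial om u) :
      IsMonomial om (A.mode (om i j) p u)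

/-- `H` is the Hermitian form `(·|·)_H` associated to the vectors `ω^{ij}`: the sesquilinear form
(linear in the first variable, conjugate linear in the second) with
`(au|bv)_H = a b̄ (u|v)` for `a, b ∈ ℂ` and all monomials `u, v` in the modes of the `ω^{ij}`,
where `(·|·)` is the normalized invariant bilinear form. -/
def IsAssociatedHermitianForm {n : ℕ} (om : Fin n → Fin n → V)
    (H : V →ₗ[ℂ] V →ₛₗ[starRingEnd ℂ] ℂ) : Prop :=
  ∃ B : V →ₗ[ℂ] V →ₗ[ℂ] ℂ, A.IsNormalizedInvariantForm B ∧
    ∀ u v : V, A.IsMonomial om u → A.IsMonomial om v →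
      ∀ a b : ℂ, H (a • u) (b • v) = a * conj b * B u v

end VertexOperatorAlgebra

/-- `c_m = 1 - 6 / ((m+2)(m+3))`. -/
def centralChargeC (m : ℕ) : ℂ := 1 - 6 / (((m : ℂ) + 2) * ((m : ℂ) + 3))

/-- `h^{(m)}_{r,s} = ([r(m+3) - s(m+2)]² - 1) / (4(m+2)(m+3))`. -/
def weightH (m r s : ℕ) : ℂ :=
  (((r : ℂ) * ((m : ℂ) + 3) - (s : ℂ) * ((m : ℂ) + 2)) ^ 2 - 1) /
    (4 * ((m : ℂ) + 2) * ((m : ℂ) + 3))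

namespace VertexOperatorAlgebra

variable {V : Type*} [AddCommGroup V] [Module ℂ V] (A : VertexOperatorAlgebra V)

/-- Condition (I): `V` is simple, of OZ type, and generated by its Griess algebra `V_2`. -/
structure ConditionI : Prop where
  simple : A.IsSimple
  oz : A.IsOZ
  generated : A.generatedBy (A.gr 2 : Set V) = ⊤

/-- Condition (II) for the vectors `ω^{ij}`, `1 ≤ i, j ≤ n`, `i ≠ j`. (The values `om i i` play
no role.) -/
structure ConditionII (n m : ℕ) (om : Fin n → Fin n → V) : Prop where
  symm : ∀ i j, om i j = om j i
  span : A.gr 2 = Submodule.span ℂ {v | ∃ i j : Fin n, i < j ∧ v = om i j}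
  virasoro : ∀ i j, i ≠ j → A.IsSimpleVirasoroVector (om i j) (centralChargeC m)
  product : ∀ i j l, i ≠ j → i ≠ l → j ≠ l →
    A.mode (om i j) 1 (om j l) = (weightH m (m + 1) 1 / 2) • (om i j + om j l - om i l)
  disjoint : ∀ i j k l, i ≠ j → i ≠ k → i ≠ l → j ≠ k → j ≠ l → k ≠ l →
    ∀ p : ℤ, 0 ≤ p → A.mode (om i j) p (om k l) = 0
  norm : ∀ i j, i ≠ j → A.mode (om i j) 3 (om i j) = (centralChargeC m / 2) • A.vac
  adjacent : ∀ i j l, i ≠ j → i ≠ l → j ≠ l →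
    A.mode (om i j) 3 (om j l) = (centralChargeC m * weightH m (m + 1) 1 / 8) • A.vac

/-- `H` is positive definite on the subspace `W`: `(v|v)_H` is a positive real for `0 ≠ v ∈ W`. -/
def PositiveDefiniteOn (H : V →ₗ[ℂ] V →ₛₗ[starRingEnd ℂ] ℂ) (W : Submodule ℂ V) : Prop :=
  ∀ v ∈ W, v ≠ 0 → (H v v).im = 0 ∧ 0 < (H v v).re

end VertexOperatorAlgebra

end

/-! The form on the span of the `ω^{ij}` is governed by their Gram matrix, and since each
`ω^{kl}` is annihilated by `L(1)`, invariance gives `(ω^{ij} | ω^{kl}) 1 = ω^{kl}_3 ω^{ij}`.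
Hence the entries are `a = c_m / 2` on the diagonal, `b = c_m h / 8` for pairs sharing one
index (with `h = m(m+1)/4`), and `0` for disjoint pairs. If `N` is the incidence matrix of
indices and pairs, this matrix equals `(a - 2b) 1 + b NᵀN`, positive definite for `2b < a`,
that is for `m(m+1) < 8`. Conversely the alternating sum of the `ω^{ij}` around a 4-cycle
has norm `4(a - 2b)`. For `n = 3` there are no disjoint pairs, so the matrix is
`(a - b) 1 + b J` with `J` all ones, while `ω^{12} - ω^{23}` has norm `2(a - b)`; the
condition becomes `b < a`, that is `m(m+1) < 16`. -/

namespace VertexOperatorAlgebra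

section Grading

variable {V : Type*} [AddCommGroup V] [Module ℂ V] (A : VertexOperatorAlgebra V)

theorem gr_eq_eigenspace (k : ℤ) : A.gr k = (A.L 0).eigenspace (k : ℂ) := by
  have hle : A.gr ≤ fun k : ℤ => (A.L 0).eigenspace (k : ℂ) := fun k v hv =>
    Module.End.mem_eigenspace_iff.2 (A.L_zero k v hv)
  have hindep : iSupIndep fun k : ℤ => (A.L 0).eigenspace (k : ℂ) :=
    (A.L 0).eigenspaces_iSupIndep.comp Int.cast_injective
  exact congrFun
    ((hindep.le_iff_eq_of_iSup_eq_top A.gr_internal.submodule_iSup_eq_top).1 hle) k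

theorem L_mem_gr {k : ℤ} {u : V} (hu : u ∈ A.gr k) (p : ℤ) : A.L p u ∈ A.gr (k - p) := by
  have hcomm : A.L 0 (A.L p u) - A.L p (A.L 0 u) = -(p : ℂ) • A.L p u := by
    simpa [L, mode] using A.virasoro 0 p u
  rw [gr_eq_eigenspace, Module.End.mem_eigenspace_iff] at hu ⊢
  rw [hu, map_smul, sub_eq_iff_eq_add] at hcomm
  rw [hcomm]
  push_cast
  module

theorem L_one_eq_zero_of_gr_one_eq_bot (h : A.gr 1 = ⊥) {u : V} (hu : u ∈ A.gr 2) :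
    A.L 1 u = 0 := by
  simpa [h] using A.L_mem_gr hu 1

end Grading

section InvariantForm

variable {V : Type*} [AddCommGroup V] [Module ℂ V] {A : VertexOperatorAlgebra V}

theorem IsInvariant.apply_mode_right {B : V →ₗ[ℂ] V →ₗ[ℂ] ℂ} (hB : A.IsInvariant B) {k : ℤ}
    {u : V} (hu : u ∈ A.gr k) (hL : A.L 1 u = 0) (v w : V) (n : ℤ) :
    B v (A.mode u n w) =
      ((Int.negOnePow k : ℤ) : ℂ) * B (A.mode u (2 * k - n - 2) v) w := by
  rw [hB k u hu v w n, finsum_eq_single _ 0]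
  · simp
  · intro i hi
    have hpow : (A.L 1 ^ i) u = 0 := by
      obtain ⟨j, rfl⟩ := Nat.exists_eq_succ_of_ne_zero hi
      rw [pow_succ, Module.End.mul_apply, hL, map_zero]
    simp [hpow, mode]

theorem IsInvariant.apply_eq_mode_three {B : V →ₗ[ℂ] V →ₗ[ℂ] ℂ} (hB : A.IsInvariant B) {u : V}
    (hu : u ∈ A.gr 2) (hL : A.L 1 u = 0) (v : V) :
    B v u = B (A.mode u 3 v) A.vac := by
  have hcreate : A.mode u (-1) A.vac = u := A.mode_neg_one_vac u
  simpa [hcreate] using hB.apply_mode_right hu hL v A.vac (-1)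

theorem IsMonomial.of_lt {n : ℕ} {om : Fin n → Fin n → V} {i j : Fin n} (hij : i < j) :
    A.IsMonomial om (om i j) := by
  have hcreate : A.mode (om i j) (-1) A.vac = om i j := A.mode_neg_one_vac _
  exact hcreate ▸ IsMonomial.mode i j hij (-1) A.vac IsMonomial.vac

theorem IsMonomial.of_ne {n : ℕ} {om : Fin n → Fin n → V} (hsymm : ∀ i j, om i j = om j i)
    {i j : Fin n} (hij : i ≠ j) : A.IsMonomial om (om i j) := by
  rcases hij.lt_or_gt with h | h
  · exact .of_lt h
  · exact hsymm i j ▸ .of_lt h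

end InvariantForm

section GramMatrix

theorem setOf_exists_lt_eq_range {V ι : Type*} [LT ι] (e : ι → ι → V) :
    {v | ∃ i j : ι, i < j ∧ v = e i j} =
      Set.range fun p : {p : ι × ι // p.1 < p.2} => e p.1.1 p.1.2 := by
  ext v
  simp [eq_comm]

variable {V ι : Type*} [AddCommGroup V] [Module ℂ V] {H : V →ₗ[ℂ] V →ₛₗ[starRingEnd ℂ] ℂ}

open scoped ComplexOrder

theorem mem_span_setOf_exists_lt [LinearOrder ι] {e : ι → ι → V} (hsymm : ∀ i j, e i j = e j i)
    {i j : ι} (hij : i ≠ j) : e i j ∈ Submodule.span ℂ {v | ∃ i j : ι, i < j ∧ v = e i j} := by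
  rcases hij.lt_or_gt with h | h
  · exact Submodule.subset_span ⟨i, j, h, rfl⟩
  · exact Submodule.subset_span ⟨j, i, h, hsymm i j⟩

theorem positiveDefiniteOn_span_range_of_posDef_gram {v : ι → V}
    (hG : (Matrix.of fun p q => H (v q) (v p)).PosDef) :
    PositiveDefiniteOn H (Submodule.span ℂ (Set.range v)) := by
  intro x hx hx0
  obtain ⟨a, rfl⟩ := Finsupp.mem_span_range_iff_exists_finsupp.1 hx
  have ha : a ≠ 0 := by
    rintro rfl
    exact hx0 Finsupp.sum_zero_index
  have hexp : H (a.sum fun p z => z • v p) (a.sum fun p z => z • v p) =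
      a.sum fun p z => a.sum fun q w => star z * H (v q) (v p) * w := by
    simp only [Finsupp.sum, map_sum, LinearMap.sum_apply, map_smul, LinearMap.smul_apply,
      LinearMap.map_smulₛₗ, smul_eq_mul, Finset.mul_sum, starRingEnd_apply]
    exact Finset.sum_congr rfl fun p _ => Finset.sum_congr rfl fun q _ => by ring
  obtain ⟨hre, him⟩ := Complex.pos_iff.1 (hG.2 ha)
  rw [hexp]
  exact ⟨him.symm, hre⟩

theorem positiveDefiniteOn_span_range_of_gram_eq {κ : Type*} [Fintype κ] [Finite ι]
    [DecidableEq ι] {v : ι → V} {α β : ℝ} (hα : 0 < α) (hβ : 0 ≤ β) (N : Matrix κ ι ℂ)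
    (hN : (Matrix.of fun p q => H (v q) (v p)) = α • 1 + β • (N.conjTranspose * N)) :
    PositiveDefiniteOn H (Submodule.span ℂ (Set.range v)) := by
  refine positiveDefiniteOn_span_range_of_posDef_gram ?_
  rw [hN]
  exact (Matrix.PosDef.one.smul hα).add_posSemidef
    ((Matrix.posSemidef_conjTranspose_mul_self N).smul hβ)

theorem PositiveDefiniteOn.re_apply_nonneg {W : Submodule ℂ V} (hpos : PositiveDefiniteOn H W)
    {v : V} (hv : v ∈ W) : 0 ≤ (H v v).re := by
  rcases eq_or_ne v 0 with rfl | hv0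
  · simp
  · exact (hpos v hv hv0).2.le

/-- The vectors `e i j = e j i`, for `i ≠ j`, have as Gram matrix `a • 1 + b • T`, where `T` is the
adjacency matrix of the triangular graph, in which two distinct pairs `{i, j}` are joined when they
share an index. The values `e i i` are irrelevant. -/
structure IsTriangularGram (H : V →ₗ[ℂ] V →ₛₗ[starRingEnd ℂ] ℂ) (e : ι → ι → V) (a b : ℝ) :
    Prop where
  symm : ∀ i j, e i j = e j i
  self : ∀ i j, i ≠ j → H (e i j) (e i j) = a
  adjacent : ∀ i j k, i ≠ j → i ≠ k → j ≠ k → H (e i j) (e j k) = b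
  disjoint : ∀ i j k l, i ≠ j → i ≠ k → i ≠ l → j ≠ k → j ≠ l → k ≠ l → H (e i j) (e k l) = 0

namespace IsTriangularGram

variable {e : ι → ι → V} {a b : ℝ}

theorem apply_eq_ite [DecidableEq ι] (hG : IsTriangularGram H e a b) {i j k l : ι} (hij : i ≠ j)
    (hkl : k ≠ l) :
    H (e i j) (e k l) = if (i = k ∧ j = l) ∨ (i = l ∧ j = k) then (a : ℂ) else
      if i = k ∨ i = l ∨ j = k ∨ j = l then (b : ℂ) else 0 := by
  have := hG.symm i j
  have := hG.symm k l
  have := hG.self i j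
  have := hG.adjacent i j k
  have := hG.adjacent i j l
  have := hG.adjacent j i k
  have := hG.adjacent j i l
  have := hG.disjoint i j k l
  grind

theorem apply_sub_self (hG : IsTriangularGram H e a b) {i j k : ι} (hij : i ≠ j) (hik : i ≠ k)
    (hjk : j ≠ k) : H (e i j - e j k) (e i j - e j k) = (2 * (a - b) : ℝ) := by
  classical
  simp only [map_sub, LinearMap.sub_apply, hG.apply_eq_ite hij hij, hG.apply_eq_ite hij hjk,
    hG.apply_eq_ite hjk hij, hG.apply_eq_ite hjk hjk]
  simp only [hij, hij.symm, hik, hik.symm, hjk, hjk.symm, and_self, and_true, and_false, or_self,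
    or_true, or_false, if_true, if_false, Complex.ofReal_mul, Complex.ofReal_ofNat,
    Complex.ofReal_sub]
  ring

theorem apply_four_cycle_self (hG : IsTriangularGram H e a b) {i j k l : ι} (hij : i ≠ j)
    (hik : i ≠ k) (hil : i ≠ l) (hjk : j ≠ k) (hjl : j ≠ l) (hkl : k ≠ l) :
    H (e i j - e j k + e k l - e l i) (e i j - e j k + e k l - e l i) =
      (4 * (a - 2 * b) : ℝ) := by
  classical
  simp only [map_sub, map_add, LinearMap.sub_apply, LinearMap.add_apply,
    hG.apply_eq_ite, ne_eq, hij, hjk, hkl, hil.symm, not_false_eq_true]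
  simp only [hij.symm, hik, hik.symm, hil, hjk.symm, hjl, hjl.symm, hkl.symm, and_self, and_true,
    and_false, or_self, or_true, or_false, if_true, if_false, add_zero, zero_sub, sub_zero,
    Complex.ofReal_mul, Complex.ofReal_ofNat, Complex.ofReal_sub]
  ring

section Span

variable [LinearOrder ι]

theorem positiveDefiniteOn_of_two_mul_lt [Finite ι] (hG : IsTriangularGram H e a b) (hb : 0 ≤ b)
    (hab : 2 * b < a) :
    PositiveDefiniteOn H (Submodule.span ℂ {v | ∃ i j : ι, i < j ∧ v = e i j}) := by
  have := Fintype.ofFinite ι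
  rw [setOf_exists_lt_eq_range]
  refine positiveDefiniteOn_span_range_of_gram_eq (sub_pos.2 hab) hb (κ := ι)
    (Matrix.of fun x p => (if x = p.1.1 then 1 else 0) + if x = p.1.2 then 1 else 0) ?_
  ext ⟨⟨i, j⟩, hij : i < j⟩ ⟨⟨k, l⟩, hkl : k < l⟩
  -- The entry of `NᵀN` at two pairs is the number of indices they share.
  simp only [hG.apply_eq_ite hkl.ne hij.ne, Matrix.add_apply, Matrix.smul_apply, Matrix.one_apply,
    Matrix.mul_apply, Matrix.conjTranspose_apply, Matrix.of_apply, Subtype.mk.injEq,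
    Prod.mk.injEq, star_add, RCLike.star_def, MonoidWithZeroHom.map_ite_one_zero, mul_add, mul_ite,
    mul_one, mul_zero, Finset.sum_add_distrib, Finset.sum_ite_eq', Finset.mem_univ, if_true,
    Complex.real_smul, Complex.ofReal_sub, Complex.ofReal_mul, Complex.ofReal_ofNat]
  grind

theorem positiveDefiniteOn_of_lt_of_card_le_three [Fintype ι] (hG : IsTriangularGram H e a b)
    (hcard : Fintype.card ι ≤ 3) (hb : 0 ≤ b) (hab : b < a) :
    PositiveDefiniteOn H (Submodule.span ℂ {v | ∃ i j : ι, i < j ∧ v = e i j}) := by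
  rw [setOf_exists_lt_eq_range]
  refine positiveDefiniteOn_span_range_of_gram_eq (sub_pos.2 hab) hb (κ := Unit)
    (Matrix.of fun _ _ => 1) ?_
  ext ⟨⟨i, j⟩, hij : i < j⟩ ⟨⟨k, l⟩, hkl : k < l⟩
  have hmeet : i = k ∨ i = l ∨ j = k ∨ j = l := by
    by_contra! h
    have h4 : 3 < (Finset.univ : Finset ι).card :=
      Finset.three_lt_card_iff.2 ⟨i, j, k, l, by simp [h, hij.ne, hkl.ne]⟩
    exact h4.not_ge hcard
  simp only [hG.apply_eq_ite hkl.ne hij.ne, Matrix.add_apply, Matrix.smul_apply,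
    Matrix.one_apply, Matrix.mul_apply, Matrix.conjTranspose_apply, Matrix.of_apply,
    Subtype.mk.injEq, Prod.mk.injEq, star_one, mul_one, Fintype.sum_unique, Complex.real_smul,
    Complex.ofReal_sub]
  grind

theorem le_of_positiveDefiniteOn [Fintype ι] (hG : IsTriangularGram H e a b)
    (hcard : 3 ≤ Fintype.card ι)
    (hpos : PositiveDefiniteOn H (Submodule.span ℂ {v | ∃ i j : ι, i < j ∧ v = e i j})) :
    b ≤ a := by
  obtain ⟨i, j, k, hij, hik, hjk⟩ := Fintype.two_lt_card_iff.1 hcard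
  have hmem : ∀ {p q}, p ≠ q → e p q ∈ _ := mem_span_setOf_exists_lt hG.symm
  have hnonneg := hpos.re_apply_nonneg (sub_mem (hmem hij) (hmem hjk))
  rw [hG.apply_sub_self hij hik hjk, Complex.ofReal_re] at hnonneg
  linarith

theorem two_mul_le_of_positiveDefiniteOn [Fintype ι] (hG : IsTriangularGram H e a b)
    (hcard : 4 ≤ Fintype.card ι)
    (hpos : PositiveDefiniteOn H (Submodule.span ℂ {v | ∃ i j : ι, i < j ∧ v = e i j})) :
    2 * b ≤ a := by
  obtain ⟨i, j, k, l, -, -, -, -, hij, hik, hil, hjk, hjl, hkl⟩ :=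
    Finset.three_lt_card_iff.1 (Finset.card_univ (α := ι) ▸ hcard)
  have hmem : ∀ {p q}, p ≠ q → e p q ∈ _ := mem_span_setOf_exists_lt hG.symm
  have hnonneg := hpos.re_apply_nonneg
    (sub_mem (add_mem (sub_mem (hmem hij) (hmem hjk)) (hmem hkl)) (hmem hil.symm))
  rw [hG.apply_four_cycle_self hij hik hil hjk hjl hkl, Complex.ofReal_re] at hnonneg
  linarith

-- If `a = b` here, or `a = 2 * b` in the next lemma, the Gram matrix is singular, and definiteness
-- on the span depends on the linear relations between the vectors.
theorem positiveDefiniteOn_iff_lt [Fintype ι] (hG : IsTriangularGram H e a b)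
    (hcard : Fintype.card ι = 3) (hb : 0 ≤ b) (hne : b ≠ a) :
    PositiveDefiniteOn H (Submodule.span ℂ {v | ∃ i j : ι, i < j ∧ v = e i j}) ↔ b < a :=
  ⟨fun hpos => (hG.le_of_positiveDefiniteOn hcard.ge hpos).lt_of_ne hne,
    hG.positiveDefiniteOn_of_lt_of_card_le_three hcard.le hb⟩

theorem positiveDefiniteOn_iff_two_mul_lt [Fintype ι] (hG : IsTriangularGram H e a b)
    (hcard : 4 ≤ Fintype.card ι) (hb : 0 ≤ b) (hne : 2 * b ≠ a) :
    PositiveDefiniteOn H (Submodule.span ℂ {v | ∃ i j : ι, i < j ∧ v = e i j}) ↔ 2 * b < a :=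
  ⟨fun hpos => (hG.two_mul_le_of_positiveDefiniteOn hcard hpos).lt_of_ne hne,
    hG.positiveDefiniteOn_of_two_mul_lt hb⟩

end Span

end IsTriangularGram

end GramMatrix

theorem IsAssociatedHermitianForm.isTriangularGram {V : Type*} [AddCommGroup V] [Module ℂ V]
    {A : VertexOperatorAlgebra V} {n : ℕ} {om : Fin n → Fin n → V} {a b : ℝ}
    {H : V →ₗ[ℂ] V →ₛₗ[starRingEnd ℂ] ℂ} (hH : A.IsAssociatedHermitianForm om H)
    (hsymm : ∀ i j, om i j = om j i) (hmem : ∀ i j, i ≠ j → om i j ∈ A.gr 2)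
    (hL : ∀ i j, i ≠ j → A.L 1 (om i j) = 0)
    (hself : ∀ i j, i ≠ j → A.mode (om i j) 3 (om i j) = (a : ℂ) • A.vac)
    (hadjacent : ∀ i j k, i ≠ j → i ≠ k → j ≠ k →
      A.mode (om i j) 3 (om j k) = (b : ℂ) • A.vac)
    (hdisjoint : ∀ i j k l, i ≠ j → i ≠ k → i ≠ l → j ≠ k → j ≠ l → k ≠ l →
      A.mode (om i j) 3 (om k l) = 0) :
    IsTriangularGram H om a b := by
  obtain ⟨B, hB, hHB⟩ := hH
  have apply_eq : ∀ {i j k l : Fin n} {r : ℂ}, i ≠ j → k ≠ l →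
      A.mode (om k l) 3 (om i j) = r • A.vac → H (om i j) (om k l) = r := by
    intro i j k l r hij hkl hr
    calc H (om i j) (om k l) = B (om i j) (om k l) := by
          simpa using hHB _ _ (.of_ne hsymm hij) (.of_ne hsymm hkl) 1 1
      _ = B (A.mode (om k l) 3 (om i j)) A.vac :=
          hB.invariant.apply_eq_mode_three (hmem k l hkl) (hL k l hkl) _
      _ = r := by rw [hr, map_smul, LinearMap.smul_apply, hB.vac_vac, smul_eq_mul, mul_one]
  refine ⟨hsymm, fun i j hij => apply_eq hij hij (hself i j hij), fun i j k hij hik hjk => ?_,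
    fun i j k l hij hik hil hjk hjl hkl => ?_⟩
  · apply apply_eq hij hjk
    rw [hsymm j k, hsymm i j]
    exact hadjacent k j i hjk.symm hik.symm hij.symm
  · apply apply_eq hij hkl
    rw [zero_smul]
    exact hdisjoint k l i j hkl hik.symm hjk.symm hil.symm hjl.symm hij

end VertexOperatorAlgebra

theorem centralChargeC_eq_ofReal (m : ℕ) :
    centralChargeC m = ((m * (m + 5) / ((m + 2) * (m + 3)) : ℝ) : ℂ) := by
  have h2 : (m : ℂ) + 2 ≠ 0 := by exact_mod_cast Nat.succ_ne_zero (m + 1)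
  have h3 : (m : ℂ) + 3 ≠ 0 := by exact_mod_cast Nat.succ_ne_zero (m + 2)
  rw [centralChargeC]
  push_cast
  field_simp
  ring

theorem weightH_succ_one (m : ℕ) : weightH m (m + 1) 1 = m * (m + 1) / 4 := by
  have h2 : (m : ℂ) + 2 ≠ 0 := by exact_mod_cast Nat.succ_ne_zero (m + 1)
  have h3 : (m : ℂ) + 3 ≠ 0 := by exact_mod_cast Nat.succ_ne_zero (m + 2)
  rw [weightH]
  push_cast
  field_simp
  ring

theorem mul_succ_lt_sixteen_iff {m : ℕ} : m * (m + 1) < 16 ↔ m ≤ 3 :=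
  ⟨fun h => by by_contra!; nlinarith, fun h => by nlinarith⟩

theorem mul_succ_ne_sixteen (m : ℕ) : m * (m + 1) ≠ 16 := by
  rcases le_or_gt m 3 with h | h <;> nlinarith

theorem two_mul_mul_succ_lt_sixteen_iff {m : ℕ} : 2 * (m * (m + 1)) < 16 ↔ m ≤ 2 :=
  ⟨fun h => by by_contra!; nlinarith, fun h => by nlinarith⟩

theorem two_mul_mul_succ_ne_sixteen (m : ℕ) : 2 * (m * (m + 1)) ≠ 16 := by
  rcases le_or_gt m 2 with h | h <;> nlinarith

open VertexOperatorAlgebra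

theorem mainTheorem4_general {V : Type*} [AddCommGroup V] [Module ℂ V]
    (A : VertexOperatorAlgebra V) (n m : ℕ) (hm : 1 ≤ m) (om : Fin n → Fin n → V)
    (hL : ∀ i j, i ≠ j → A.L 1 (om i j) = 0)
    (hsymm : ∀ i j, om i j = om j i)
    (hspan : A.gr 2 = Submodule.span ℂ {v | ∃ i j : Fin n, i < j ∧ v = om i j})
    (hself : ∀ i j, i ≠ j → A.mode (om i j) 3 (om i j) = (centralChargeC m / 2) • A.vac)
    (hadjacent : ∀ i j l, i ≠ j → i ≠ l → j ≠ l →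
      A.mode (om i j) 3 (om j l) = (centralChargeC m * weightH m (m + 1) 1 / 8) • A.vac)
    (hdisjoint : ∀ i j k l, i ≠ j → i ≠ k → i ≠ l → j ≠ k → j ≠ l → k ≠ l →
      A.mode (om i j) 3 (om k l) = 0)
    (H : V →ₗ[ℂ] V →ₛₗ[starRingEnd ℂ] ℂ) (hH : A.IsAssociatedHermitianForm om H) :
    (n = 3 → (PositiveDefiniteOn H (A.gr 2) ↔ m ≤ 3)) ∧
      (4 ≤ n → (PositiveDefiniteOn H (A.gr 2) ↔ m ≤ 2)) := by
  obtain ⟨t, ht, hc⟩ : ∃ t : ℝ, 0 < t ∧ centralChargeC m = (32 * t : ℝ) :=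
    ⟨_, div_pos (by positivity) (by norm_num),
      (centralChargeC_eq_ofReal m).trans (congrArg _ (mul_div_cancel₀ _ (by norm_num)).symm)⟩
  have hmem : ∀ i j, i ≠ j → om i j ∈ A.gr 2 := fun i j hij =>
    hspan ▸ mem_span_setOf_exists_lt hsymm hij
  have hG : IsTriangularGram H om (t * (16 : ℕ)) (t * (m * (m + 1) : ℕ)) := by
    refine hH.isTriangularGram hsymm hmem hL (fun i j hij => ?_) (fun i j k hij hik hjk => ?_)
      hdisjoint
    · rw [hself i j hij, hc]
      push_cast
      ring_nf
    · rw [hadjacent i j k hij hik hjk, hc, weightH_succ_one]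
      push_cast
      ring_nf
  have hb : 0 ≤ t * (m * (m + 1) : ℕ) := by positivity
  have htwo : 2 * (t * (m * (m + 1) : ℕ)) = t * (2 * (m * (m + 1)) : ℕ) := by
    push_cast
    ring
  have scale_ne {k : ℕ} (hk : k ≠ 16) : t * k ≠ t * (16 : ℕ) :=
    (mul_right_injective₀ ht.ne').ne (Nat.cast_injective.ne hk)
  rw [hspan]
  refine ⟨?_, fun hn => ?_⟩
  · rintro rfl
    rw [hG.positiveDefiniteOn_iff_lt (Fintype.card_fin 3) hb (scale_ne (mul_succ_ne_sixteen m)),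
      mul_lt_mul_iff_right₀ ht, Nat.cast_lt, mul_succ_lt_sixteen_iff]
  · rw [hG.positiveDefiniteOn_iff_two_mul_lt ((Fintype.card_fin n).symm ▸ hn) hb
        (htwo ▸ scale_ne (two_mul_mul_succ_ne_sixteen m)),
      htwo, mul_lt_mul_iff_right₀ ht, Nat.cast_lt, two_mul_mul_succ_lt_sixteen_iff]

theorem mainTheorem4 {V : Type*} [AddCommGroup V] [Module ℂ V] (A : VertexOperatorAlgebra V)
    (n m : ℕ) (hn : 3 ≤ n) (hm : 2 ≤ m) (om : Fin n → Fin n → V)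
    (hI : A.ConditionI) (hII : A.ConditionII n m om)
    (H : V →ₗ[ℂ] V →ₛₗ[starRingEnd ℂ] ℂ) (hH : A.IsAssociatedHermitianForm om H) :
    (n = 3 → (VertexOperatorAlgebra.PositiveDefiniteOn H (A.gr 2) ↔ m ≤ 3)) ∧
      (4 ≤ n → (VertexOperatorAlgebra.PositiveDefiniteOn H (A.gr 2) ↔ m = 2)) := by
  have hL : ∀ i j, i ≠ j → A.L 1 (om i j) = 0 := fun i j hij =>
    A.L_one_eq_zero_of_gr_one_eq_bot hI.oz.2.2 (hII.virasoro i j hij).1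
  simpa only [hm.ge_iff_eq'] using mainTheorem4_general A n m (by omega) om hL hII.symm hII.span
    hII.norm hII.adjacent (fun i j k l hij hik hil hjk hjl hkl =>
      hII.disjoint i j k l hij hik hil hjk hjl hkl 3 (by norm_num)) H hH
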